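/- Consider three kinds of unit equilateral triangles in the triangular grid: unfilled upwards oriented (one corner at the top), unfilled downwards oriented (one corner at the bottom), and filled upwards oriented. Let $\mu$ be the substitution that doubles lengths and replaces each unit triangle by an equilateral triangle of side length $2$ with the same orientation, divided into four unit triangles: the central one has the opposite orientation and is unfilled, and the three corner ones are copies of the triangle that is replaced (unfilled upwards, unfilled downwards, or filled upwards, respectively). Let $T_k=\mu^k(\text{filled upwards unit triangle})$, a triangle of side length $2^k$. The triangle $T_k$ is the top part of side length $2^k$ of $T_{k+1}$; let $T$, the Sierpiński triangle, be the limit of the $T_k$ under these inclusions, an infinite triangular region tiled by the three kinds of unit triangles, with its apex at the top. A triangular pattern of side length $n$ occurring in $T$ is an equilateral triangle consisting of $n$ rows of unit triangles of $T$, lying entirely in $T$, with each of its unit triangles marked by its kind; two patterns are the same if they have the same orientation and agree up to translation. For $n\ge 1$ let $A_n$ be the number of distinct upwards oriented triangular patterns of side length $n$ that occur in $T$, and let $A'_n$ be the number of distinct downwards oriented ones. Then $$A_n = 4n^2-6n+4 \quad\text{for all } n\ge 1,$$ and $$A'_1 = 1,\qquad A'_n = n^2-3n+4\quad\text{for all }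 n\ge 2.$$ -/

import Mathlib

namespace Sierpinski

/-- The three kinds of unit triangles: unfilled upwards oriented, unfilled downwards oriented, and
filled upwards oriented. -/
inductive Tile
  | up
  | down
  | filled
  deriving DecidableEq

/-- The substitution on a single tile.  The image is a triangle of size `2` with the orientation
of the tile; its unit triangles are indexed by `(i, j)`, with `i` the row counted from the top and
`j` the column counted from the left, both starting from `0`.  So for an upwards oriented tile the
indices are `(0, 0), (1, 0), (1, 1), (1, 2)`, the central triangle being `(1, 1)`, and for a
downwards oriented tile they are `(0, 0), (0, 1), (0, 2), (1, 0)`, the central triangle being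
`(0, 1)`. -/
def Tile.subst : Tile → ℕ → ℕ → Tile
  | .up, i, j => if i = 1 ∧ j = 1 then .down else .up
  | .down, i, j => if i = 0 ∧ j = 1 then .up else .down
  | .filled, i, j => if i = 1 ∧ j = 1 then .down else .filled

/-- A patch of tiles in the triangular grid that fills an infinite triangular region with its apex
at the top.  Position `(r, c)` is the `c`-th unit triangle from the left in the `r`-th row from the
top, both counted from `0`; row `r` of the region has the positions `c = 0, ..., 2 * r`, which are
upwards oriented for even `c` and downwards oriented for odd `c`.  The value `none` means that the
patch has no tile there. -/
abbrev Patch := ℕ → ℕ → Option Tile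

/-- The substitution `μ` on patches: distances from the apex are doubled, and every tile is replaced
by its image.  The image of the tile at `(r, 2 * j)` covers column `4 * j` of row `2 * r` and
columns `4 * j, 4 * j + 1, 4 * j + 2` of row `2 * r + 1`; the image of the tile at `(r, 2 * j + 1)`
covers columns `4 * j + 1, 4 * j + 2, 4 * j + 3` of row `2 * r` and column `4 * j + 3` of row
`2 * r + 1`. -/
def mu (x : Patch) : Patch := fun r c =>
  if r % 2 = 0 then
    if c % 4 = 0 then (x (r / 2) (2 * (c / 4))).map fun t => t.subst 0 0
    else (x (r / 2) (2 * (c / 4) + 1)).map fun t => t.subst 0 (c % 4 - 1)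
  else
    if c % 4 = 3 then (x (r / 2) (2 * (c / 4) + 1)).map fun t => t.subst 1 0
    else (x (r / 2) (2 * (c / 4))).map fun t => t.subst 1 (c % 4)

/-- The seed: a single filled unit triangle at the apex. -/
def seed : Patch := fun r c => if r = 0 ∧ c = 0 then some .filled else none

/-- The super-tiles `T_k = μ^k (seed)`, triangles of size `2 ^ k` with common apex. -/
def superTile (k : ℕ) : Patch := mu^[k] seed

theorem superTile_succ (k : ℕ) : superTile (k + 1) = mu (superTile k) :=
  Function.iterate_succ_apply' mu k seed

/-- The super-tiles are nested: `T_k` consists of the first `2 ^ k` rows of `T_(k+1)`. -/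
theorem superTile_succ_eq (k r c : ℕ) (h : r < 2 ^ k) :
    superTile (k + 1) r c = superTile k r c := by
  induction k generalizing r c with
  | zero =>
    obtain rfl : r = 0 := by simpa using h
    by_cases hc : c % 4 = 0
    · by_cases h0 : c = 0
      · subst h0; simp [superTile, mu, seed, Tile.subst]
      · have : c / 4 ≠ 0 := by omega
        simp [superTile, mu, seed, hc, h0, this]
    · have : c ≠ 0 := by rintro rfl; simp at hc
      simp [superTile, mu, seed, hc, this]
  | succ k ih =>
    have h2 : r / 2 < 2 ^ k := by rw [pow_succ] at h; omega
    rw [superTile_succ (k + 1), superTile_succ k]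
    have key : ∀ d, mu (superTile k) (r / 2) d = superTile k (r / 2) d := fun d => by
      rw [← superTile_succ]; exact ih _ d h2
    simp only [mu] at key ⊢
    rw [key, key]

/-- The Sierpiński triangle `T`: the limit of the nested super-tiles `T_k`.  Row `r` is already
complete in `T_r`, as `r < 2 ^ r`. -/
def T : Patch := fun r c => superTile r r c

/-- `T` is the limit of the super-tiles: its first `2 ^ k` rows are `T_k`. -/
theorem T_eq_superTile (k r c : ℕ) (h : r < 2 ^ k) : T r c = superTile k r c := by
  have key : ∀ a b, r < 2 ^ a → superTile (a + b) r c = superTile a r c := by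
    intro a b ha
    induction b with
    | zero => rfl
    | succ b ih =>
      rw [← add_assoc, superTile_succ_eq _ _ _ (ha.trans_le
        (Nat.pow_le_pow_right (by norm_num) (Nat.le_add_right a b))), ih]
  have h1 := key k r h
  have h2 := key r k Nat.lt_two_pow_self
  rw [add_comm] at h2
  exact h2.symm.trans h1

/-- The unit triangles `(i, j)` of an upwards oriented triangle of size `n`, with `i` the row
counted from the top and `j` the column counted from the left: row `i` has `2 * i + 1` of them. -/
abbrev UpCell (n : ℕ) := {p : ℕ × ℕ // p.1 < n ∧ p.2 < 2 * p.1 + 1}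

/-- The unit triangles `(i, j)` of a downwards oriented triangle of size `n`: row `i` has
`2 * (n - i) - 1` of them. -/
abbrev DownCell (n : ℕ) := {p : ℕ × ℕ // p.1 < n ∧ p.2 < 2 * (n - p.1) - 1}

/-- The set of upwards oriented triangular patterns of size `n` that occur in `T`.  The
subtriangle with top unit triangle at `(r, c)`, where `c` is even, has its `i`-th row starting at
column `c` of row `r + i`. -/
def upPatterns (n : ℕ) : Set (UpCell n → Tile) :=
  {u | ∃ r c : ℕ, Even c ∧ ∀ p : UpCell n, T (r + p.1.1) (c + p.1.2) = some (u p)}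

/-- The set of downwards oriented triangular patterns of size `n` that occur in `T`.  The
subtriangle with top left unit triangle at `(r, c)`, where `c` is odd, has its `i`-th row starting
at column `c + 2 * i` of row `r + i`. -/
def downPatterns (n : ℕ) : Set (DownCell n → Tile) :=
  {u | ∃ r c : ℕ, Odd c ∧ ∀ p : DownCell n, T (r + p.1.1) (c + 2 * p.1.1 + p.1.2) = some (u p)}

end Sierpinski

namespace Sierpinski

/-! The filled triangles of `T` are the odd entries of Pascal's triangle (`T_eq`), since Lucas'
theorem modulo 2 is exactly the substitution. In `D (i+1) (j+1) = D i j + D i (j+1)` any two of the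
three entries determine the third. So an upwards pattern of size `n` carries the same information as
a row segment of length `2n-1` centred at its apex, and a downwards one the same as the `n-1`
upwards unit triangles of its top row. With `p L` the number of factors of length `L` of the rows,
`A_n = p (2n-1)` and `A'_n = p (n-1)`.

Even rows of Pascal's triangle interleave a row with zeros, odd rows double each letter.
Desubstituting in the four parity classes of (row, column) and subtracting overlaps gives
`ncard_rowFactors_recursion`, whence `p L = L^2 - L + 2` for `L ≥ 1`. Borders are harmless: by
`exists_interior_window`, windows reaching into the zeros right of the triangle also occur inside
it. -/

/-! ### Lucas' theorem, periodicity and recurrence of windows -/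

/-- Pascal's triangle modulo `2`. -/
def pascal (r c : ℕ) : ZMod 2 := (r.choose c : ZMod 2)

theorem pascal_succ_succ (r c : ℕ) : pascal (r + 1) (c + 1) = pascal r c + pascal r (c + 1) := by
  simp [pascal, Nat.choose_succ_succ]

theorem pascal_eq_mul (r c : ℕ) :
    pascal r c = pascal (r % 2) (c % 2) * pascal (r / 2) (c / 2) := by
  have h := Choose.choose_modEq_choose_mod_mul_choose_div_nat (n := r) (k := c) (p := 2)
  rw [← ZMod.natCast_eq_natCast_iff] at h
  simpa [pascal] using h

theorem pascal_even_even (a b : ℕ) : pascal (2 * a) (2 * b) = pascal a b := by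
  rw [pascal_eq_mul]; simp [pascal]

theorem pascal_even_odd (a b : ℕ) : pascal (2 * a) (2 * b + 1) = 0 := by
  rw [pascal_eq_mul]; simp [pascal, Nat.add_mod]

theorem pascal_odd_even (a b : ℕ) : pascal (2 * a + 1) (2 * b) = pascal a b := by
  rw [pascal_eq_mul]
  simp [pascal, Nat.add_mod, show (2 * a + 1) / 2 = a by omega]

theorem pascal_odd_odd (a b : ℕ) : pascal (2 * a + 1) (2 * b + 1) = pascal a b := by
  rw [pascal_eq_mul]
  simp [pascal, Nat.add_mod, show (2 * a + 1) / 2 = a by omega, show (2 * b + 1) / 2 = b by omega]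

theorem pascal_zero_right (r : ℕ) : pascal r 0 = 1 := by simp [pascal]

theorem pascal_zero_succ (c : ℕ) : pascal 0 (c + 1) = 0 := by simp [pascal]

theorem pascal_eq_zero {r c : ℕ} (h : r < c) : pascal r c = 0 := by
  simp [pascal, Nat.choose_eq_zero_of_lt h]

/-- The `2 ^ k`-periodicity of Pascal's triangle along the left edge. -/
theorem pascal_add_two_pow (k r c : ℕ) (hr : r < 2 ^ k) (hc : c < 2 ^ k) :
    pascal (r + 2 ^ k) c = pascal r c := by
  induction k generalizing r c with
  | zero =>
    obtain rfl : r = 0 := by simpa using hr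
    obtain rfl : c = 0 := by simpa using hc
    simp [pascal]
  | succ k ih =>
    rw [pascal_eq_mul, pascal_eq_mul r c,
      show (r + 2 ^ (k + 1)) % 2 = r % 2 by rw [pow_succ]; omega,
      show (r + 2 ^ (k + 1)) / 2 = r / 2 + 2 ^ k by rw [pow_succ]; omega,
      ih _ _ (by rw [pow_succ] at hr; omega) (by rw [pow_succ] at hc; omega)]

/-- The `2 ^ k`-periodicity of Pascal's triangle along the right edge. -/
theorem pascal_add_two_pow_add_two_pow (k r c : ℕ) (hr : r < 2 ^ k) :
    pascal (r + 2 ^ k) (c + 2 ^ k) = pascal r c := by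
  induction k generalizing r c with
  | zero =>
    obtain rfl : r = 0 := by simpa using hr
    simpa only [zero_add, pow_zero, pascal_zero_succ, add_zero] using pascal_succ_succ 0 c
  | succ k ih =>
    rw [pascal_eq_mul, pascal_eq_mul r c,
      show (r + 2 ^ (k + 1)) % 2 = r % 2 by rw [pow_succ]; omega,
      show (r + 2 ^ (k + 1)) / 2 = r / 2 + 2 ^ k by rw [pow_succ]; omega,
      show (c + 2 ^ (k + 1)) % 2 = c % 2 by rw [pow_succ]; omega,
      show (c + 2 ^ (k + 1)) / 2 = c / 2 + 2 ^ k by rw [pow_succ]; omega,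
      ih _ _ (by rw [pow_succ] at hr; omega)]

theorem pascal_two_pow_sub_one (k c : ℕ) (hc : c < 2 ^ k) : pascal (2 ^ k - 1) c = 1 := by
  induction k generalizing c with
  | zero =>
    obtain rfl : c = 0 := by simpa using hc
    simp [pascal]
  | succ k ih =>
    have hk : 0 < 2 ^ k := by positivity
    have hc2 : c / 2 < 2 ^ k := by rw [pow_succ] at hc; omega
    rw [show 2 ^ (k + 1) - 1 = 2 * (2 ^ k - 1) + 1 by rw [pow_succ]; omega]
    rcases Nat.even_or_odd' c with ⟨b, rfl | rfl⟩
    · rw [pascal_odd_even, ih _ (by omega)]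
    · rw [pascal_odd_odd, ih _ (by omega)]

/-- Every finite window of Pascal's triangle modulo `2`, also if it exceeds the triangle on the
right, reoccurs arbitrarily far from both edges. -/
theorem exists_interior_window (r c n s : ℕ) : ∃ r' c', s ≤ c' ∧ c' + s ≤ r' ∧
    ∀ i ≤ n, ∀ j ≤ n, pascal (r' + i) (c' + j) = pascal (r + i) (c + j) := by
  have hk : r + c + n + s < 2 ^ (r + c + n + s) := Nat.lt_two_pow_self
  set k := r + c + n + s with hkdef
  -- The shift along the right edge leaves the left edge; the larger shift along the left edge then
  -- leaves the right one.
  refine ⟨r + 2 ^ k + 2 ^ (k + 1), c + 2 ^ k, by omega, by rw [pow_succ]; omega, ?_⟩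
  intro i hi j hj
  rw [show r + 2 ^ k + 2 ^ (k + 1) + i = (r + i + 2 ^ k) + 2 ^ (k + 1) by ring,
    show c + 2 ^ k + j = c + j + 2 ^ k by ring,
    pascal_add_two_pow _ _ _ (by rw [pow_succ]; omega) (by rw [pow_succ]; omega),
    pascal_add_two_pow_add_two_pow _ _ _ (by omega)]

/-- Used throughout to count one kind of window by another: only equality of windows has to be
compared, no bijection is built. -/
theorem ncard_range_congr {ι α β : Type*} {f : ι → α} {g : ι → β}
    (h : ∀ i j, f i = f j ↔ g i = g j) : (Set.range f).ncard = (Set.range g).ncard := by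
  refine Set.ncard_congr (fun a ha => g ha.choose) (fun a ha => ⟨_, rfl⟩) ?_ ?_
  · intro a b ha hb hab
    rw [← ha.choose_spec, ← hb.choose_spec]
    exact (h _ _).2 hab
  · rintro _ ⟨i, rfl⟩
    refine ⟨f i, ⟨i, rfl⟩, (h _ _).1 ?_⟩
    exact Exists.choose_spec (p := fun j => f j = f i) ⟨i, rfl⟩

/-! ### Counting the factors of the rows of Pascal's triangle modulo `2` -/

/-- The factor of length `L` of row `r` that starts at column `c`. -/
def rowFactor (L : ℕ) (x : ℕ × ℕ) : Fin L → ZMod 2 := fun j => pascal x.1 (x.2 + j)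

theorem rowFactor_eq_iff (L : ℕ) (x y : ℕ × ℕ) :
    rowFactor L x = rowFactor L y ↔
      ∀ j < L, pascal x.1 (x.2 + j) = pascal y.1 (y.2 + j) := by
  simp [funext_iff, Fin.forall_iff, rowFactor]

/-- The factors of length `L` of the rows of Pascal's triangle modulo `2`. -/
def rowFactors (L : ℕ) : Set (Fin L → ZMod 2) := Set.range (rowFactor L)

theorem range_rowFactor_add (L s : ℕ) :
    Set.range (fun x : ℕ × ℕ => rowFactor L (x.1, x.2 + s)) = rowFactors L := by
  apply Set.Subset.antisymm
  · rintro _ ⟨x, rfl⟩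
    exact ⟨_, rfl⟩
  · rintro _ ⟨⟨r, c⟩, rfl⟩
    obtain ⟨r', c', h1, -, h⟩ := exists_interior_window r c L s
    refine ⟨(r', c' - s), ?_⟩
    rw [rowFactor_eq_iff]
    intro j hj
    simpa [Nat.sub_add_cancel h1] using h 0 (Nat.zero_le _) j hj.le

/-! ### Desubstitution in the four parity classes -/

/-- The factors in rows with parity `e` at columns with parity `f`. -/
def parityFactors (L e f : ℕ) : Set (Fin L → ZMod 2) :=
  Set.range fun x : ℕ × ℕ => rowFactor L (2 * x.1 + e, 2 * x.2 + f)

theorem ncard_parityFactors_zero_zero (L : ℕ) :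
    (parityFactors L 0 0).ncard = (rowFactors ((L + 1) / 2)).ncard := by
  refine ncard_range_congr fun x y => ?_
  simp only [rowFactor_eq_iff, add_zero]
  constructor
  · intro h j hj
    have := h (2 * j) (by omega)
    simpa only [← mul_add, pascal_even_even] using this
  · intro h j hj
    rcases Nat.even_or_odd' j with ⟨i, rfl | rfl⟩
    · simpa only [← mul_add, pascal_even_even] using h i (by omega)
    · simp only [← add_assoc, ← mul_add, pascal_even_odd]

theorem ncard_parityFactors_zero_one (L : ℕ) :
    (parityFactors L 0 1).ncard = (rowFactors (L / 2)).ncard := by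
  -- The factor begins with an interleaved zero, so its preimage starts at column `x.2 + 1`.
  rw [← range_rowFactor_add _ 1]
  refine ncard_range_congr fun x y => ?_
  simp only [rowFactor_eq_iff, add_zero]
  have key : ∀ b i : ℕ, 2 * b + 1 + (2 * i + 1) = 2 * (b + 1 + i) := fun b i => by ring
  constructor
  · intro h j hj
    have := h (2 * j + 1) (by omega)
    simpa only [key, pascal_even_even] using this
  · intro h j hj
    rcases Nat.even_or_odd' j with ⟨i, rfl | rfl⟩
    · simp only [add_right_comm _ 1, ← mul_add, pascal_even_odd]
    · simpa only [key, pascal_even_even] using h i (by omega)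

theorem ncard_parityFactors_one_zero (L : ℕ) :
    (parityFactors L 1 0).ncard = (rowFactors ((L + 1) / 2)).ncard := by
  refine ncard_range_congr fun x y => ?_
  simp only [rowFactor_eq_iff, add_zero]
  constructor
  · intro h j hj
    have := h (2 * j) (by omega)
    simpa only [← mul_add, pascal_odd_even] using this
  · intro h j hj
    rcases Nat.even_or_odd' j with ⟨i, rfl | rfl⟩
    · simpa only [← mul_add, pascal_odd_even] using h i (by omega)
    · simpa only [← add_assoc, ← mul_add, pascal_odd_odd] using h i (by omega)

/-- The first letter is the second half of a doubled letter, so the preimage has one more letter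
than the remaining `L - 1` letters alone would need. -/
theorem ncard_parityFactors_one_one (L : ℕ) (hL : 1 ≤ L) :
    (parityFactors L 1 1).ncard = (rowFactors (L / 2 + 1)).ncard := by
  refine ncard_range_congr fun x y => ?_
  simp only [rowFactor_eq_iff]
  have key : ∀ b i : ℕ, 2 * b + 1 + (2 * i + 1) = 2 * (b + (i + 1)) := fun b i => by ring
  constructor
  · intro h j hj
    rcases j with _ | j
    · simpa only [add_zero, pascal_odd_odd] using h 0 (by omega)
    · simpa only [key, pascal_odd_even] using h (2 * j + 1) (by omega)
  · intro h j hj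
    rcases Nat.even_or_odd' j with ⟨i, rfl | rfl⟩
    · simpa only [add_right_comm _ 1, ← mul_add, pascal_odd_odd] using h i (by omega)
    · simpa only [key, pascal_odd_even] using h (i + 1) (by omega)

theorem rowFactors_eq_union (L : ℕ) :
    rowFactors L = (parityFactors L 0 0 ∪ parityFactors L 0 1) ∪
      (parityFactors L 1 0 ∪ parityFactors L 1 1) := by
  apply Set.Subset.antisymm
  · rintro _ ⟨⟨r, c⟩, rfl⟩
    rcases Nat.even_or_odd' r with ⟨a, rfl | rfl⟩ <;>
    rcases Nat.even_or_odd' c with ⟨b, rfl | rfl⟩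
    · exact Or.inl (Or.inl ⟨(a, b), rfl⟩)
    · exact Or.inl (Or.inr ⟨(a, b), rfl⟩)
    · exact Or.inr (Or.inl ⟨(a, b), rfl⟩)
    · exact Or.inr (Or.inr ⟨(a, b), rfl⟩)
  · rintro _ ((⟨x, rfl⟩ | ⟨x, rfl⟩) | (⟨x, rfl⟩ | ⟨x, rfl⟩)) <;> exact ⟨_, rfl⟩

theorem rowFactor_even_mem (L a c : ℕ) :
    rowFactor L (2 * a, c) ∈ parityFactors L 0 0 ∪ parityFactors L 0 1 := by
  rcases Nat.even_or_odd' c with ⟨b, rfl | rfl⟩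
  · exact Or.inl ⟨(a, b), rfl⟩
  · exact Or.inr ⟨(a, b), rfl⟩

theorem rowFactor_odd_mem (L a c : ℕ) :
    rowFactor L (2 * a + 1, c) ∈ parityFactors L 1 0 ∪ parityFactors L 1 1 := by
  rcases Nat.even_or_odd' c with ⟨b, rfl | rfl⟩
  · exact Or.inl ⟨(a, b), rfl⟩
  · exact Or.inr ⟨(a, b), rfl⟩

/-! ### Overlaps of the parity classes -/

theorem eq_zero_of_mem_parityFactors_zero_zero {L : ℕ} {w : Fin L → ZMod 2}
    (hw : w ∈ parityFactors L 0 0) (j : ℕ) (hj : 2 * j + 1 < L) : w ⟨2 * j + 1, hj⟩ = 0 := by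
  obtain ⟨x, rfl⟩ := hw
  simp only [rowFactor, add_zero, ← add_assoc, ← mul_add, pascal_even_odd]

theorem eq_zero_of_mem_parityFactors_zero_one {L : ℕ} {w : Fin L → ZMod 2}
    (hw : w ∈ parityFactors L 0 1) (j : ℕ) (hj : 2 * j < L) : w ⟨2 * j, hj⟩ = 0 := by
  obtain ⟨x, rfl⟩ := hw
  simp only [rowFactor, add_zero, add_right_comm _ 1, ← mul_add, pascal_even_odd]

theorem eq_of_mem_parityFactors_one_zero {L : ℕ} {w : Fin L → ZMod 2}
    (hw : w ∈ parityFactors L 1 0) (j : ℕ) (hj : 2 * j + 1 < L) :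
    w ⟨2 * j, by omega⟩ = w ⟨2 * j + 1, hj⟩ := by
  obtain ⟨x, rfl⟩ := hw
  simp only [rowFactor, add_zero, ← add_assoc, ← mul_add, pascal_odd_odd, pascal_odd_even]

theorem eq_of_mem_parityFactors_one_one {L : ℕ} {w : Fin L → ZMod 2}
    (hw : w ∈ parityFactors L 1 1) (j : ℕ) (hj : 2 * j + 2 < L) :
    w ⟨2 * j + 1, by omega⟩ = w ⟨2 * j + 2, hj⟩ := by
  obtain ⟨x, rfl⟩ := hw
  simp only [rowFactor, show 2 * x.2 + 1 + (2 * j + 1) = 2 * (x.2 + j + 1) by ring,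
    show 2 * x.2 + 1 + (2 * j + 2) = 2 * (x.2 + j + 1) + 1 by ring,
    pascal_odd_odd, pascal_odd_even]

theorem rowFactor_zero_succ (L c : ℕ) : rowFactor L (0, c + 1) = 0 := by
  funext j
  exact pascal_eq_zero (by dsimp only; omega)

theorem rowFactor_one_add_two (L c : ℕ) : rowFactor L (1, c + 2) = 0 := by
  funext j
  exact pascal_eq_zero (by dsimp only; omega)

theorem parityFactors_zero_inter (L : ℕ) :
    parityFactors L 0 0 ∩ parityFactors L 0 1 = {0} := by
  apply Set.Subset.antisymm
  · rintro w ⟨h0, h1⟩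
    refine Set.mem_singleton_iff.2 (funext fun ⟨j, hj⟩ => ?_)
    rcases Nat.even_or_odd' j with ⟨i, rfl | rfl⟩
    · exact eq_zero_of_mem_parityFactors_zero_one h1 i hj
    · exact eq_zero_of_mem_parityFactors_zero_zero h0 i hj
  · rintro _ rfl
    exact ⟨⟨(0, 1), rowFactor_zero_succ L 1⟩, ⟨(0, 0), rowFactor_zero_succ L 0⟩⟩

theorem rowFactor_two_pow_sub_one {L k c : ℕ} (h : L + c ≤ 2 ^ k) :
    rowFactor L (2 ^ k - 1, c) = 1 := by
  funext j
  exact pascal_two_pow_sub_one _ _ (by have := j.2; simp only; omega)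

theorem parityFactors_one_inter (L : ℕ) (hL : 1 ≤ L) :
    parityFactors L 1 0 ∩ parityFactors L 1 1 = {0, 1} := by
  apply Set.Subset.antisymm
  · rintro w ⟨h0, h1⟩
    -- The two pairings together link all neighbouring letters, so the word is constant.
    have key : ∀ j (hj : j < L), w ⟨j, hj⟩ = w ⟨0, hL⟩ := by
      intro j
      induction j with
      | zero => intro _; rfl
      | succ j ih =>
        intro hj
        rw [← ih (by omega)]
        rcases Nat.even_or_odd' j with ⟨i, rfl | rfl⟩
        · exact (eq_of_mem_parityFactors_one_zero h0 i hj).symm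
        · exact (eq_of_mem_parityFactors_one_one h1 i hj).symm
    have h2 : ∀ z : ZMod 2, z = 0 ∨ z = 1 := by decide
    rcases h2 (w ⟨0, hL⟩) with h | h
    · exact Or.inl (funext fun j => (key j j.2).trans h)
    · exact Or.inr (funext fun j => (key j j.2).trans h)
  · have hk : L + 1 < 2 ^ (L + 1) := Nat.lt_two_pow_self
    have hodd : 2 * (2 ^ L - 1) + 1 = 2 ^ (L + 1) - 1 := by rw [pow_succ] at hk ⊢; omega
    rintro _ (rfl | rfl)
    · exact ⟨⟨(0, 1), rowFactor_one_add_two L 0⟩, ⟨(0, 1), rowFactor_one_add_two L 1⟩⟩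
    · refine ⟨⟨(2 ^ L - 1, 0), ?_⟩, ⟨(2 ^ L - 1, 0), ?_⟩⟩
      · simp only [hodd]
        exact rowFactor_two_pow_sub_one (by omega)
      · simp only [hodd]
        exact rowFactor_two_pow_sub_one (by omega)

theorem rowFactor_zero_zero (L : ℕ) (hL : 1 ≤ L) :
    rowFactor L (0, 0) = Pi.single ⟨0, hL⟩ 1 := by
  funext ⟨j, hj⟩
  rcases j with _ | j
  · simp [rowFactor, pascal]
  · simp [rowFactor, pascal]

theorem rowFactor_one_one (L : ℕ) (hL : 1 ≤ L) :
    rowFactor L (1, 1) = Pi.single ⟨0, hL⟩ 1 := by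
  funext ⟨j, hj⟩
  rcases j with _ | j
  · simp [rowFactor, pascal]
  · rw [Pi.single_apply, if_neg (by simp)]
    exact pascal_eq_zero (by dsimp only; omega)

/-- Row `2 ^ k + e` has a gap of zeros strictly between columns `e` and `2 ^ k`; the window ends at
the 1 that closes the gap. -/
theorem rowFactor_two_pow_add {L k e : ℕ} (hL : 1 ≤ L) (hk : L + e < 2 ^ k) (he : e < 2 ^ k) :
    rowFactor L (e + 2 ^ k, 2 ^ k + 1 - L) = Pi.single ⟨L - 1, by omega⟩ 1 := by
  funext ⟨j, hj⟩
  rw [Pi.single_apply]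
  simp only [rowFactor, Fin.mk.injEq]
  split_ifs with h
  · rw [show 2 ^ k + 1 - L + j = 0 + 2 ^ k by omega, pascal_add_two_pow_add_two_pow _ _ _ he,
      pascal_zero_right]
  · rw [pascal_add_two_pow _ _ _ he (by omega), pascal_eq_zero (by omega)]

/-- Zeros on alternate positions, together with equality in adjacent pairs, kill every letter except
possibly an unpaired one at an end of the word. -/
theorem parityFactors_inter (L : ℕ) (hL : 2 ≤ L) :
    (parityFactors L 0 0 ∪ parityFactors L 0 1) ∩ (parityFactors L 1 0 ∪ parityFactors L 1 1) =
      {0, Pi.single ⟨0, by omega⟩ 1, Pi.single ⟨L - 1, by omega⟩ 1} := by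
  apply Set.Subset.antisymm
  · rintro w ⟨hE, hO⟩
    have h2 : ∀ z : ZMod 2, z ≠ 0 → z = 1 := by decide
    have hzero : ∀ k (hk : k < L), (∀ j (hj : j < L), j ≠ k → w ⟨j, hj⟩ = 0) →
        w = 0 ∨ w = Pi.single ⟨k, hk⟩ 1 := by
      intro k hk h
      by_cases h0 : w ⟨k, hk⟩ = 0
      · refine Or.inl (funext fun ⟨j, hj⟩ => ?_)
        by_cases hjk : j = k
        · subst hjk; exact h0
        · exact h j hj hjk
      · refine Or.inr (funext fun ⟨j, hj⟩ => ?_)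
        by_cases hjk : j = k
        · subst hjk; simpa using h2 _ h0
        · rw [h j hj hjk, Pi.single_apply, if_neg (by simpa using hjk)]
    have hfirst : (∀ j (hj : j < L), j ≠ 0 → w ⟨j, hj⟩ = 0) →
        w ∈ ({0, Pi.single ⟨0, by omega⟩ 1, Pi.single ⟨L - 1, by omega⟩ 1} :
          Set (Fin L → ZMod 2)) := fun h => by
      rcases hzero 0 (by omega) h with h | h
      · exact Or.inl h
      · exact Or.inr (Or.inl h)
    have hlast : (∀ j (hj : j < L), j ≠ L - 1 → w ⟨j, hj⟩ = 0) →
        w ∈ ({0, Pi.single ⟨0, by omega⟩ 1, Pi.single ⟨L - 1, by omega⟩ 1} :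
          Set (Fin L → ZMod 2)) := fun h => by
      rcases hzero (L - 1) (by omega) h with h | h
      · exact Or.inl h
      · exact Or.inr (Or.inr h)
    rcases hE with hE | hE <;> rcases hO with hO | hO
    · have e := eq_zero_of_mem_parityFactors_zero_zero hE
      have o := eq_of_mem_parityFactors_one_zero hO
      refine hlast fun j hj hne => ?_
      rcases Nat.even_or_odd' j with ⟨i, rfl | rfl⟩
      · rw [o i (by omega), e i]
      · exact e i hj
    · have e := eq_zero_of_mem_parityFactors_zero_zero hE
      have o := eq_of_mem_parityFactors_one_one hO
      refine hfirst fun j hj hne => ?_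
      rcases Nat.even_or_odd' j with ⟨_ | i, rfl | rfl⟩
      · exact absurd rfl hne
      · exact e 0 hj
      · exact (o i hj).symm.trans (e i _)
      · exact e _ hj
    · have e := eq_zero_of_mem_parityFactors_zero_one hE
      have o := eq_of_mem_parityFactors_one_zero hO
      refine hfirst fun j hj hne => ?_
      rcases Nat.even_or_odd' j with ⟨i, rfl | rfl⟩
      · exact e i hj
      · exact (o i hj).symm.trans (e i _)
    · have e := eq_zero_of_mem_parityFactors_zero_one hE
      have o := eq_of_mem_parityFactors_one_one hO
      refine hlast fun j hj hne => ?_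
      rcases Nat.even_or_odd' j with ⟨i, rfl | rfl⟩
      · exact e i hj
      · exact (o i (by omega)).trans (e (i + 1) _)
  · have hk : L + 1 < 2 ^ (L + 1) := Nat.lt_two_pow_self
    rintro _ (rfl | rfl | rfl)
    · refine ⟨?_, ?_⟩
      · simpa [rowFactor_zero_succ L 0] using rowFactor_even_mem L 0 1
      · simpa [rowFactor_one_add_two L 0] using rowFactor_odd_mem L 0 2
    · refine ⟨?_, ?_⟩
      · simpa only [mul_zero, rowFactor_zero_zero L (by omega)] using rowFactor_even_mem L 0 0
      · simpa only [mul_zero, zero_add, rowFactor_one_one L (by omega)] using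
          rowFactor_odd_mem L 0 1
    · refine ⟨?_, ?_⟩
      · rw [← rowFactor_two_pow_add (k := L + 1) (e := 0) (by omega) (by omega) (by omega),
          show 0 + 2 ^ (L + 1) = 2 * 2 ^ L by ring]
        exact rowFactor_even_mem _ _ _
      · rw [← rowFactor_two_pow_add (k := L + 1) (e := 1) (by omega) (by omega) (by omega),
          show 1 + 2 ^ (L + 1) = 2 * 2 ^ L + 1 by ring]
        exact rowFactor_odd_mem _ _ _

/-- Inclusion-exclusion over the parity classes: the 6 is the sum of the overlaps of size 1, 2 and
3. -/
theorem ncard_rowFactors_recursion (L : ℕ) (hL : 2 ≤ L) :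
    (rowFactors L).ncard + 6 = 2 * (rowFactors ((L + 1) / 2)).ncard +
      (rowFactors (L / 2)).ncard + (rowFactors (L / 2 + 1)).ncard := by
  have h0 := Set.ncard_union_add_ncard_inter (parityFactors L 0 0) (parityFactors L 0 1)
    (Set.toFinite _) (Set.toFinite _)
  have h1 := Set.ncard_union_add_ncard_inter (parityFactors L 1 0) (parityFactors L 1 1)
    (Set.toFinite _) (Set.toFinite _)
  have h := Set.ncard_union_add_ncard_inter (parityFactors L 0 0 ∪ parityFactors L 0 1)
    (parityFactors L 1 0 ∪ parityFactors L 1 1) (Set.toFinite _) (Set.toFinite _)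
  have : Nonempty (Fin L) := ⟨⟨0, by omega⟩⟩
  have hne : (Pi.single ⟨0, by omega⟩ 1 : Fin L → ZMod 2) ≠ Pi.single ⟨L - 1, by omega⟩ 1 := by
    intro h
    have := congrFun h ⟨0, by omega⟩
    rw [Pi.single_eq_same, Pi.single_apply, if_neg (by simp; omega)] at this
    exact one_ne_zero this
  rw [parityFactors_zero_inter, Set.ncard_singleton, ncard_parityFactors_zero_zero,
    ncard_parityFactors_zero_one] at h0
  rw [parityFactors_one_inter L (by omega), Set.ncard_pair zero_ne_one,
    ncard_parityFactors_one_zero, ncard_parityFactors_one_one L (by omega)] at h1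
  rw [← rowFactors_eq_union, parityFactors_inter L hL,
    Set.ncard_eq_three.2 ⟨_, _, _, by simp [eq_comm], by simp [eq_comm], hne, rfl⟩] at h
  omega

theorem ncard_rowFactors_one : (rowFactors 1).ncard = 2 := by
  have h : rowFactors 1 = Set.univ := by
    refine Set.eq_univ_of_univ_subset ?_
    intro w _
    have h2 : ∀ w : Fin 1 → ZMod 2, w = 0 ∨ w = 1 := by decide
    rcases h2 w with rfl | rfl
    · exact ⟨_, rowFactor_zero_succ 1 0⟩
    · exact ⟨_, rowFactor_two_pow_sub_one (k := 0) (c := 0) (by norm_num)⟩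
  rw [h, Set.ncard_univ, Nat.card_eq_fintype_card]
  rfl

theorem ncard_rowFactors_two : (rowFactors 2).ncard = 4 := by
  have h : rowFactors 2 = Set.univ := by
    refine Set.eq_univ_of_univ_subset ?_
    intro w _
    have h2 : ∀ w : Fin 2 → ZMod 2,
        w = 0 ∨ w = 1 ∨ w = Pi.single 0 1 ∨ w = Pi.single 1 1 := by decide
    rcases h2 w with rfl | rfl | rfl | rfl
    · exact ⟨_, rowFactor_zero_succ 2 0⟩
    · exact ⟨_, rowFactor_two_pow_sub_one (k := 1) (c := 0) (by norm_num)⟩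
    · exact ⟨_, rowFactor_zero_zero 2 (by norm_num)⟩
    · exact ⟨_, rowFactor_two_pow_add (k := 2) (e := 0) (by norm_num) (by norm_num) (by norm_num)⟩
  rw [h, Set.ncard_univ, Nat.card_eq_fintype_card]
  rfl

theorem ncard_rowFactors_zero : (rowFactors 0).ncard = 1 := by
  rw [rowFactors, Set.range_eq_singleton fun _ => Subsingleton.elim _ 0, Set.ncard_singleton]

theorem ncard_rowFactors (L : ℕ) (hL : 1 ≤ L) :
    ((rowFactors L).ncard : ℤ) = (L : ℤ) ^ 2 - L + 2 := by
  induction L using Nat.strong_induction_on with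
  | _ L ih =>
    by_cases h1 : L = 1
    · subst h1; simp [ncard_rowFactors_one]
    -- A separate base case, since `L / 2 + 1 = L` here and the recursion does not descend.
    by_cases h2 : L = 2
    · subst h2; simp [ncard_rowFactors_two]
    have h := ncard_rowFactors_recursion L (by omega)
    have ha := ih ((L + 1) / 2) (by omega) (by omega)
    have hb := ih (L / 2) (by omega) (by omega)
    have hc := ih (L / 2 + 1) (by omega) (by omega)
    zify at h
    rcases Nat.even_or_odd' L with ⟨m, rfl | rfl⟩
    · rw [show (2 * m + 1) / 2 = m by omega] at ha h
      rw [show (2 * m) / 2 = m by omega] at hb hc h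
      push_cast at *
      linarith
    · rw [show (2 * m + 1 + 1) / 2 = m + 1 by omega] at ha h
      rw [show (2 * m + 1) / 2 = m by omega] at hb hc h
      push_cast at *
      linarith

/-! ### Solutions of Pascal's recursion on triangles -/

theorem eq_zero_below_of_row_eq_zero {D : ℕ → ℕ → ZMod 2}
    (hD : ∀ i j, D (i + 1) (j + 1) = D i j + D i (j + 1)) {N : ℕ} (h : ∀ j < N, D 0 j = 0)
    (i j : ℕ) (hij : i ≤ j) (hj : j < N) : D i j = 0 := by
  induction i generalizing j with
  | zero => exact h j hj
  | succ i ih =>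
    obtain ⟨j, rfl⟩ : ∃ k, j = k + 1 := ⟨j - 1, by omega⟩
    rw [hD, ih _ (by omega) (by omega), ih _ (by omega) hj, add_zero]

/-- The recursion is solved sideways: vanishing spreads from the triangle to its left and right, one
diagonal at a time (`k` is the distance from the triangle), until the whole row segment is reached.
-/
theorem row_eq_zero_of_triangle_eq_zero {D : ℕ → ℕ → ZMod 2}
    (hD : ∀ i j, D (i + 1) (j + 1) = D i j + D i (j + 1)) {m : ℕ}
    (h : ∀ i ≤ m, ∀ j ≤ i, D i (m + j) = 0) (j : ℕ) (hj : j < 2 * m + 1) : D 0 j = 0 := by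
  have left : ∀ k i, i + k ≤ m → D i (m - k) = 0 := by
    intro k
    induction k with
    | zero => intro i hi; exact h i hi 0 (Nat.zero_le _)
    | succ k ih =>
      intro i hi
      have e := hD i (m - (k + 1))
      rw [show m - (k + 1) + 1 = m - k by omega, ih _ (by omega), ih _ (by omega), add_zero] at e
      exact e.symm
  have right : ∀ k i, i + k ≤ m → D i (m + i + k) = 0 := by
    intro k
    induction k with
    | zero => intro i hi; exact h i hi i le_rfl
    | succ k ih =>
      intro i hi
      have e := hD i (m + i + k)
      rw [ih _ (by omega), show m + i + k + 1 = m + (i + 1) + k by ring, ih _ (by omega),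
        zero_add] at e
      rw [show m + i + (k + 1) = m + (i + 1) + k by ring]
      exact e.symm
  by_cases hjm : j ≤ m
  · have := left (m - j) 0 (by omega)
    rwa [show m - (m - j) = j by omega] at this
  · have := right (j - m) 0 (by omega)
    rwa [show m + 0 + (j - m) = j by omega] at this

theorem pascal_sub_recursion (r c r' c' i j : ℕ) :
    pascal (r + (i + 1)) (c + (j + 1)) - pascal (r' + (i + 1)) (c' + (j + 1)) =
      (pascal (r + i) (c + j) - pascal (r' + i) (c' + j)) +
        (pascal (r + i) (c + (j + 1)) - pascal (r' + i) (c' + (j + 1))) := by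
  simp only [← add_assoc, pascal_succ_succ]
  ring

/-! ### The Sierpiński triangle and Pascal's triangle -/

/-- The kind of the unit triangle of `T` at position `(r, c)`. -/
def tile (r c : ℕ) : Tile :=
  if c % 2 = 1 then .down else if pascal r (c / 2) = 1 then .filled else .up

theorem tile_odd (r c : ℕ) : tile r (2 * c + 1) = .down := by
  simp [tile, Nat.add_mod]

theorem tile_even (r c : ℕ) :
    tile r (2 * c) = if pascal r c = 1 then .filled else .up := by
  simp [tile]

theorem tile_even_eq_iff (r c r' c' : ℕ) :
    tile r (2 * c) = tile r' (2 * c') ↔ pascal r c = pascal r' c' := by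
  have h : ∀ x y : ZMod 2, ((if x = 1 then Tile.filled else .up) =
    (if y = 1 then Tile.filled else .up)) ↔ x = y := by decide
  simpa [tile] using h (pascal r c) (pascal r' c')

theorem mu_T : mu T = T := by
  funext r c
  have h : mu T r c = mu (superTile r) r c := by
    have h2 : r / 2 < 2 ^ r := (Nat.div_le_self _ _).trans_lt Nat.lt_two_pow_self
    simp only [mu, T_eq_superTile r _ _ h2]
  rw [h, ← superTile_succ, superTile_succ_eq _ _ _ Nat.lt_two_pow_self]
  rfl

/-- `T` is fixed by `mu`, so row `r` comes from row `r / 2`; the tile rules then match the Lucas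
identities in each residue of `c` modulo 4. -/
theorem T_eq (r c : ℕ) : T r c = if c ≤ 2 * r then some (tile r c) else none := by
  induction r using Nat.strong_induction_on generalizing c with
  | _ r ih =>
    by_cases hr : r = 0
    · subst hr
      by_cases hc : c = 0
      · subst hc; simp [T, superTile, seed, tile, pascal]
      · simp [T, superTile, seed, hc]
    · have ih := fun d => ih (r / 2) (by omega) d
      rw [← mu_T]
      simp only [mu, ih]
      obtain ⟨b, f, hf, rfl⟩ : ∃ b f, f < 4 ∧ c = 4 * b + f :=
        ⟨c / 4, c % 4, Nat.mod_lt _ (by norm_num), by omega⟩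
      rw [show (4 * b + f) % 4 = f by omega, show (4 * b + f) / 4 = b by omega]
      rcases Nat.even_or_odd' r with ⟨a, rfl | rfl⟩
      · rw [show 2 * a / 2 = a by omega, if_pos (by omega)]
        interval_cases f
        · rw [if_pos rfl, show 4 * b + 0 = 2 * (2 * b) by ring, tile_even, tile_even,
            pascal_even_even]
          split_ifs <;> first | rfl | omega
        all_goals rw [if_neg (by norm_num), tile_odd]
        · rw [show 4 * b + 1 = 2 * (2 * b) + 1 by ring, tile_odd]
          split_ifs <;> first | rfl | omega
        · rw [show 4 * b + 2 = 2 * (2 * b + 1) by ring, tile_even, pascal_even_odd,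
            if_neg zero_ne_one]
          split_ifs <;> first | rfl | omega
        · rw [show 4 * b + 3 = 2 * (2 * b + 1) + 1 by ring, tile_odd]
          split_ifs <;> first | rfl | omega
      · rw [show (2 * a + 1) / 2 = a by omega, if_neg (by omega)]
        interval_cases f
        · rw [if_neg (by norm_num), show 4 * b + 0 = 2 * (2 * b) by ring, tile_even, tile_even,
            pascal_odd_even]
          split_ifs <;> first | rfl | omega
        · rw [if_neg (by norm_num), show 4 * b + 1 = 2 * (2 * b) + 1 by ring, tile_odd, tile_even]
          split_ifs <;> first | rfl | omega
        · rw [if_neg (by norm_num), show 4 * b + 2 = 2 * (2 * b + 1) by ring, tile_even, tile_even,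
            pascal_odd_odd]
          split_ifs <;> first | rfl | omega
        · rw [if_pos rfl, tile_odd, show 4 * b + 3 = 2 * (2 * b + 1) + 1 by ring, tile_odd]
          split_ifs <;> first | rfl | omega

theorem tile_eq_of_pascal_eq {r c r' c' j : ℕ}
    (h : pascal r (c + j / 2) = pascal r' (c' + j / 2)) :
    tile r (2 * c + j) = tile r' (2 * c' + j) := by
  rcases Nat.even_or_odd' j with ⟨i, rfl | rfl⟩
  · rw [← mul_add, ← mul_add, tile_even_eq_iff]
    simpa using h
  · rw [← add_assoc, ← add_assoc, ← mul_add, ← mul_add, tile_odd, tile_odd]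

/-! ### From triangular patterns to row factors -/

/-- Up to a reoccurrence, the upwards oriented triangles may be taken anywhere in the extension of
Pascal's triangle by zeros, at distance at least `s` from the left edge. -/
theorem upPatterns_eq_range (n s : ℕ) : upPatterns n = Set.range
    fun (x : ℕ × ℕ) (p : UpCell n) => tile (x.1 + p.1.1) (2 * (x.2 + s) + p.1.2) := by
  apply Set.Subset.antisymm
  · rintro u ⟨r, c, ⟨d, rfl⟩, hu⟩
    obtain ⟨r', c', h1, -, h⟩ := exists_interior_window r d n s
    refine ⟨(r', c' - s), funext fun p => ?_⟩
    have hp := hu p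
    obtain ⟨hp1, hp2⟩ := p.2
    rw [T_eq, ← two_mul] at hp
    split_ifs at hp
    rw [← Option.some.inj hp]
    simp only [Nat.sub_add_cancel h1]
    exact tile_eq_of_pascal_eq (h _ hp1.le _ (by omega))
  · rintro _ ⟨⟨r, c⟩, rfl⟩
    obtain ⟨r', c', -, h2, h⟩ := exists_interior_window r (c + s) n 0
    refine ⟨r', 2 * c', even_two_mul c', fun p => ?_⟩
    obtain ⟨hp1, hp2⟩ := p.2
    rw [T_eq, if_pos (by omega)]
    exact congrArg some (tile_eq_of_pascal_eq (h _ hp1.le _ (by omega)))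

/-- Up to a reoccurrence, the downwards oriented triangles may be taken anywhere in the extension
of Pascal's triangle by zeros. -/
theorem downPatterns_eq_range (n : ℕ) : downPatterns n = Set.range
    fun (x : ℕ × ℕ) (p : DownCell n) =>
      tile (x.1 + p.1.1) (2 * x.2 + (1 + 2 * p.1.1 + p.1.2)) := by
  apply Set.Subset.antisymm
  · rintro u ⟨r, c, ⟨d, rfl⟩, hu⟩
    refine ⟨(r, d), funext fun p => ?_⟩
    have hp := hu p
    rw [T_eq] at hp
    split_ifs at hp
    rw [← Option.some.inj hp]
    simp only [add_assoc]
  · rintro _ ⟨⟨r, c⟩, rfl⟩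
    obtain ⟨r', c', -, h2, h⟩ := exists_interior_window r c (n + n) (n + n)
    refine ⟨r', 2 * c' + 1, odd_two_mul_add_one c', fun p => ?_⟩
    obtain ⟨hp1, hp2⟩ := p.2
    rw [T_eq, if_pos (by omega), show 2 * c' + 1 + 2 * p.1.1 + p.1.2 =
      2 * c' + (1 + 2 * p.1.1 + p.1.2) by ring]
    exact congrArg some (tile_eq_of_pascal_eq (h _ (by omega) _ (by omega)))

theorem ncard_upPatterns (m : ℕ) :
    (upPatterns (m + 1)).ncard = (rowFactors (2 * m + 1)).ncard := by
  -- The shift by `m` makes room for the `m` columns left of the apex.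
  rw [upPatterns_eq_range _ m]
  refine ncard_range_congr fun x y => ?_
  rw [rowFactor_eq_iff]
  have hD := pascal_sub_recursion x.1 x.2 y.1 y.2
  constructor
  · intro h j hj
    refine sub_eq_zero.1 (row_eq_zero_of_triangle_eq_zero
      (D := fun i j => pascal (x.1 + i) (x.2 + j) - pascal (y.1 + i) (y.2 + j)) hD (m := m) ?_ j hj)
    intro i hi k hk
    have := congrFun h ⟨(i, 2 * k), by dsimp only; omega, by dsimp only; omega⟩
    simp only [← mul_add, tile_even_eq_iff] at this
    simpa only [sub_eq_zero, ← add_assoc] using this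
  · intro h
    funext ⟨⟨i, j⟩, hi, hj⟩
    dsimp only at hi hj
    refine tile_eq_of_pascal_eq (sub_eq_zero.1 ?_)
    rw [add_assoc, add_assoc]
    exact eq_zero_below_of_row_eq_zero
      (D := fun i j => pascal (x.1 + i) (x.2 + j) - pascal (y.1 + i) (y.2 + j)) hD
      (N := 2 * m + 1) (fun j hj => sub_eq_zero.2 (h j hj)) i _ (by dsimp only; omega) (by dsimp only; omega)

theorem ncard_downPatterns (m : ℕ) :
    (downPatterns (m + 1)).ncard = (rowFactors m).ncard := by
  -- The top row starts with a downwards triangle, so its first upwards one lies at Pascal column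
  -- `x.2 + 1`.
  rw [downPatterns_eq_range, ← range_rowFactor_add m 1]
  refine ncard_range_congr fun x y => ?_
  rw [rowFactor_eq_iff]
  have hD := pascal_sub_recursion x.1 (x.2 + 1) y.1 (y.2 + 1)
  constructor
  · intro h j hj
    have := congrFun h ⟨(0, 2 * j + 1), by dsimp only; omega, by dsimp only; omega⟩
    simp only [show ∀ a : ℕ, 2 * a + (1 + 2 * 0 + (2 * j + 1)) = 2 * (a + 1 + j) by intro a; ring,
      tile_even_eq_iff] at this
    exact this
  · intro h
    funext ⟨⟨i, j⟩, hi, hj⟩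
    dsimp only at hi hj
    rcases Nat.even_or_odd' j with ⟨k, rfl | rfl⟩
    · simp only [show ∀ a : ℕ, 2 * a + (1 + 2 * i + 2 * k) = 2 * (a + i + k) + 1 by intro a; ring,
        tile_odd]
    · simp only [show ∀ a : ℕ, 2 * a + (1 + 2 * i + (2 * k + 1)) = 2 * (a + 1 + (i + k)) by
        intro a; ring, tile_even_eq_iff]
      exact sub_eq_zero.1 (eq_zero_below_of_row_eq_zero
        (D := fun i j => pascal (x.1 + i) (x.2 + 1 + j) - pascal (y.1 + i) (y.2 + 1 + j)) hD
        (N := m) (fun j hj => sub_eq_zero.2 (h j hj)) i (i + k) (by omega) (by omega))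

end Sierpinski

theorem theorem1 :
    (∀ n : ℕ, 1 ≤ n →
      ((Sierpinski.upPatterns n).ncard : ℤ) = 4 * (n : ℤ) ^ 2 - 6 * (n : ℤ) + 4) ∧
    (Sierpinski.downPatterns 1).ncard = 1 ∧
    (∀ n : ℕ, 2 ≤ n →
      ((Sierpinski.downPatterns n).ncard : ℤ) = (n : ℤ) ^ 2 - 3 * (n : ℤ) + 4) := by
  refine ⟨fun n hn => ?_, ?_, fun n hn => ?_⟩
  · obtain ⟨m, rfl⟩ : ∃ m, n = m + 1 := ⟨n - 1, by omega⟩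
    rw [Sierpinski.ncard_upPatterns, Sierpinski.ncard_rowFactors _ (by omega)]
    push_cast
    ring
  -- Exceptional because there is one empty factor, while `L ^ 2 - L + 2` would give 2 at `L = 0`.
  · rw [Sierpinski.ncard_downPatterns 0, Sierpinski.ncard_rowFactors_zero]
  · obtain ⟨m, rfl⟩ : ∃ m, n = m + 1 := ⟨n - 1, by omega⟩
    rw [Sierpinski.ncard_downPatterns, Sierpinski.ncard_rowFactors _ (by omega)]
    push_cast
    ring
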